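/- Let $m\ge 2$, and let $\mathcal Q=\{[x]\in\mathbb{RP}^{2m} : q(x)=0\}$ be a non-degenerate quadric. Let $P:\mathbb Z^2\to\mathbb{RP}^{2m}$ be a Q-net inscribed in $\mathcal Q$, i.e. all points $P_{i,j}$ lie on $\mathcal Q$ and, for all $i,j$, the points $P_{i,j},P_{i+1,j},P_{i+1,j+1},P_{i,j+1}$ are coplanar. Let $V_i$ ($i\in\mathbb Z$) and $H_j$ ($j\in\mathbb Z$) be $m$-dimensional projective subspaces with $P_{i,j}\in V_i\cap H_j$ for all $i,j$. Assume that the net is generic in the following sense: (a) no three of the four points $P_{i,j},P_{i+1,j},P_{i+1,j+1},P_{i,j+1}$ are collinear, for all $i,j$; (b) for all $i,j$, the $m+1$ points $P_{i,j},P_{i,j+1},\dots,P_{i,j+m}$ span an $m$-dimensional subspace, and so do the $m+1$ points $P_{i,j},P_{i+1,j},\dots,P_{i+m,j}$; (c) the points $P_{i,j}$, $(i,j)\in\mathbb Z^2$, span $\mathbb{RP}^{2m}$; (d) none of the lines $P_{i,j}\vee P_{i,j+1}$ and $P_{i,j}\vee P_{i+1,j}$ is contained in $\mathcal Q$; (e)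 for all $i$ and $j$, each of the intersections $V_i\cap V_{i+1}\cap\dots\cap V_{i+m}$ and $H_j\cap H_{j+1}\cap\dots\cap H_{j+m}$ is a single point. Then there are quadrics $\mathcal V$ and $\mathcal H$ in $\mathbb{RP}^{2m}$ such that: 1. $\mathcal V$ has signature $(m,m,1)$ ($m$ plus signs, $m$ minus signs, one zero), and all $V_i$ are isotropic subspaces of $\mathcal V$, i.e. are contained in $\mathcal V$. 2. $\mathcal H$ has signature $(m,m,1)$, and all $H_j$ are isotropic subspaces of $\mathcal H$. 3. $\mathcal V$ has exactly two systems of generators; all $V_{2i}$, $i\in\mathbb Z$, belong to one of them, and all $V_{2i+1}$, $i\in\mathbb Z$, belong to the other one. 4. $\mathcal H$ has exactly two systems of generators; all $H_{2j}$, $j\in\mathbb Z$, belong to one of them, and all $H_{2j+1}$, $j\in\mathbb Z$, belong to the other one. 5. $\mathcal Q$, $\mathcal V$ and $\mathcal H$ belong to one pencil of quadrics, i.e. the quadratic forms that define them lie in a common two-dimensional linear space of quadratic forms. Here a generator of a quadric is an isotropic subspace of maximal dimension. Two generators $G_1,G_2$ of a quadric of signature $(m,m,1)$ in $\mathbb{RP}^{2m}$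 belong to the same system if, for a hyperplane $E$ that does not contain the singular point (apex) of the quadric, the dimension of $G_1\cap G_2\cap E$ (with $\dim\emptyset=-1$) has different parity than $m$; this does not depend on $E$. A system of generators consists of all generators that belong to the same system as a given one. -/

import Mathlib

open scoped LinearAlgebra.Projectivization

/-- The vector space `ℝⁿ⁺¹` whose projectivization is `ℝPⁿ`. -/
abbrev HomCoord (n : ℕ) : Type := Fin (n + 1) → ℝ

/-- Real projective space `ℝPⁿ`. -/
abbrev RP (n : ℕ) : Type := ℙ ℝ (HomCoord n)

/-- A projective subspace of `ℝPⁿ` is given by the linear subspace `S` of `ℝⁿ⁺¹` over it; its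
projective dimension is `dim S - 1` (so `-1` for the empty subspace). Joins and intersections of
projective subspaces are `⊔` and `⊓` of linear subspaces; a point `p` is the line `p.submodule`. -/
noncomputable def projDim {n : ℕ} (S : Submodule ℝ (HomCoord n)) : ℤ :=
  (Module.finrank ℝ S : ℤ) - 1

/-- A Q-net: for each elementary quadrilateral, the four vertices are coplanar. -/
def IsQNet {n : ℕ} (P : ℤ → ℤ → RP n) : Prop :=
  ∀ i j : ℤ, projDim ((P i j).submodule ⊔ (P (i + 1) j).submodule ⊔
    (P (i + 1) (j + 1)).submodule ⊔ (P i (j + 1)).submodule) ≤ 2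

/-- The projective subspace `G` is contained in the quadric `{[x] | q x = 0}`. A point `p` lies on
the quadric iff `IsIsotropic q p.submodule`. -/
def IsIsotropic {n : ℕ} (q : QuadraticForm ℝ (HomCoord n)) (G : Submodule ℝ (HomCoord n)) : Prop :=
  ∀ x ∈ G, q x = 0

/-- The quadric of `q` has signature `(p, s, r)`: `p` plus signs, `s` minus signs, `r` zeros. -/
def HasSignature {n : ℕ} (q : QuadraticForm ℝ (HomCoord n)) (p s r : ℕ) : Prop :=
  sigPos q = p ∧ sigNeg q = s ∧
    Module.finrank ℝ (QuadraticMap.radical q) = r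

/-- A generator of a quadric: an isotropic subspace of maximal dimension. -/
def IsGenerator {n : ℕ} (q : QuadraticForm ℝ (HomCoord n)) (G : Submodule ℝ (HomCoord n)) : Prop :=
  IsIsotropic q G ∧ ∀ G' : Submodule ℝ (HomCoord n), IsIsotropic q G' → projDim G' ≤ projDim G

/-- For generators `G₁`, `G₂` of a quadric of signature `(m, m, 1)` in `ℝP²ᵐ`: they belong to the
same system if, cutting with a hyperplane `E` that does not contain the apex (the singular point)
of the quadric, the dimension of the intersection of the generators `G₁ ∩ E` and `G₂ ∩ E` of the
neutral quadric in `E` has different parity than `m`. -/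
def SameSystem {m : ℕ} (q : QuadraticForm ℝ (HomCoord (2 * m)))
    (G₁ G₂ : Submodule ℝ (HomCoord (2 * m))) : Prop :=
  ∀ E : Submodule ℝ (HomCoord (2 * m)), IsCompl E (QuadraticMap.radical q) →
    ¬ projDim ((G₁ ⊓ E) ⊓ (G₂ ⊓ E)) ≡ (m : ℤ) [ZMOD 2]

/-- A system of generators of a quadric of signature `(m, m, 1)`: all the generators that belong to
the same system as some given generator. -/
def IsGeneratorSystem {m : ℕ} (q : QuadraticForm ℝ (HomCoord (2 * m)))
    (S : Set (Submodule ℝ (HomCoord (2 * m)))) : Prop :=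
  ∃ G, IsGenerator q G ∧ S = {G' | IsGenerator q G' ∧ SameSystem q G G'}

/-- The quadric of `q` has exactly two systems of generators; the even-indexed members of the
family `G` belong to one of them and the odd-indexed members to the other one. -/
def AlternatesBetweenSystems {m : ℕ} (q : QuadraticForm ℝ (HomCoord (2 * m)))
    (G : ℤ → Submodule ℝ (HomCoord (2 * m))) : Prop :=
  ∃ S₀ S₁ : Set (Submodule ℝ (HomCoord (2 * m))),
    IsGeneratorSystem q S₀ ∧ IsGeneratorSystem q S₁ ∧ S₀ ≠ S₁ ∧
    (∀ S, IsGeneratorSystem q S → S = S₀ ∨ S = S₁) ∧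
    (∀ i : ℤ, G (2 * i) ∈ S₀) ∧ (∀ i : ℤ, G (2 * i + 1) ∈ S₁)

/-- A pencil of quadrics: a projective line in the projective space of all quadrics, given by a
two-dimensional linear space of quadratic forms. -/
def IsPencil {n : ℕ} (L : Submodule ℝ (QuadraticForm ℝ (HomCoord n))) : Prop :=
  Module.finrank ℝ L = 2

/-- Genericity of a Q-net `P` in `ℝP²ᵐ` that is inscribed in the quadric of `q`, with parameter
lines in the subspaces `V i` and `H j`. -/
structure IsGenericNet {m : ℕ} (q : QuadraticForm ℝ (HomCoord (2 * m))) (P : ℤ → ℤ → RP (2 * m))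
    (V H : ℤ → Submodule ℝ (HomCoord (2 * m))) : Prop where
  /-- No three vertices of an elementary quadrilateral are collinear. -/
  quad₁ : ∀ i j : ℤ, projDim ((P i j).submodule ⊔ (P (i + 1) j).submodule ⊔
    (P i (j + 1)).submodule) = 2
  quad₂ : ∀ i j : ℤ, projDim ((P i j).submodule ⊔ (P (i + 1) j).submodule ⊔
    (P (i + 1) (j + 1)).submodule) = 2
  quad₃ : ∀ i j : ℤ, projDim ((P i j).submodule ⊔ (P i (j + 1)).submodule ⊔
    (P (i + 1) (j + 1)).submodule) = 2
  quad₄ : ∀ i j : ℤ, projDim ((P (i + 1) j).submodule ⊔ (P i (j + 1)).submodule ⊔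
    (P (i + 1) (j + 1)).submodule) = 2
  /-- Any `m + 1` consecutive vertices of a parameter line span an `m`-dimensional subspace. -/
  join_V : ∀ i j : ℤ, projDim (⨆ k : Fin (m + 1), (P i (j + (k : ℕ))).submodule) = m
  join_H : ∀ i j : ℤ, projDim (⨆ k : Fin (m + 1), (P (i + (k : ℕ)) j).submodule) = m
  /-- The vertices of `P` span `ℝP²ᵐ`. -/
  span_eq_top : (⨆ (i : ℤ) (j : ℤ), (P i j).submodule) = ⊤
  /-- The edge lines of `P` are not isotropic lines of the quadric. -/
  edge_V : ∀ i j : ℤ, ¬ IsIsotropic q ((P i j).submodule ⊔ (P i (j + 1)).submodule)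
  edge_H : ∀ i j : ℤ, ¬ IsIsotropic q ((P i j).submodule ⊔ (P (i + 1) j).submodule)
  /-- Any `m + 1` consecutive subspaces of each of the two families meet in a single point. -/
  inter_V : ∀ i : ℤ, projDim (⨅ k : Fin (m + 1), V (i + (k : ℕ))) = 0
  inter_H : ∀ j : ℤ, projDim (⨅ k : Fin (m + 1), H (j + (k : ℕ))) = 0

/-!
Choose vectors `p i j` over the vertices. Since `V i` and `H j` meet only in the isotropic line of
`p i j`, there is a functional `φ i j` that vanishes on `V i` and agrees on `H j` with the polar of
`p i j`. The functionals satisfy the same linear relations around elementary quadrilaterals as the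
vectors, so `(p i j, φ i j)` is a Q-net in `E × E*`. Its vertices span the graph of a linear map
`Φ : E → E*`, and the form `𝒱 x = Φ x x / 2` vanishes on every `V i` and agrees with `Q` on every
`H j`; put `ℋ = Q - 𝒱`.

A vector of `V i` in the radical of `𝒱` lies in `V (i + 1)`, because the edges are not isotropic,
so it lies in `m + 1` consecutive subspaces. This bounds the radical, and the signature follows
from the dimension of `V i`.

For Lagrangian subspaces `A`, `B`, `C` write the vectors `x ∈ A ⊓ (B ⊔ C)` as `t x + (x - t x)`
with `t x ∈ B` and `x - t x ∈ C`. Then `(x, y) ↦ β x (t y)` is an alternating form with radical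
`A ⊓ B ⊔ A ⊓ C`, hence of even rank. The resulting relation between the parities of the pairwise
intersections shows that there are at most two systems, and `V i`, `V (i + 1)` belong to different
ones, as they meet in codimension one.
-/

section AlternatingForms

open Module

variable {K E : Type*} [Field K] [AddCommGroup E] [Module K E]

theorem even_card_of_transpose_eq_neg [NeZero (2 : K)] {n : Type*} [Fintype n] [DecidableEq n]
    {A : Matrix n n K} (hA : A.transpose = -A) (hdet : A.det ≠ 0) :
    Even (Fintype.card n) := by
  by_contra hodd
  have h : A.det = -A.det := by
    conv_lhs => rw [← A.det_transpose, hA, Matrix.det_neg,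
      (Nat.not_even_iff_odd.1 hodd).neg_one_pow, neg_one_mul]
  have h2 : 2 * A.det = 0 := by linear_combination h
  exact hdet ((mul_eq_zero.1 h2).resolve_left two_ne_zero)

theorem even_finrank_of_isAlt_of_separatingLeft [NeZero (2 : K)] [FiniteDimensional K E]
    {ω : LinearMap.BilinForm K E} (hω : ω.IsAlt) (hsep : ω.SeparatingLeft) :
    Even (finrank K E) := by
  let b := finBasis K E
  have hskew : (LinearMap.BilinForm.toMatrix b ω).transpose =
      -LinearMap.BilinForm.toMatrix b ω := by
    ext i j
    simpa only [Matrix.transpose_apply, Matrix.neg_apply, LinearMap.BilinForm.toMatrix_apply]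
      using (hω.neg_eq (b i) (b j)).symm
  have hdet := Matrix.separatingLeft_iff_det_ne_zero.1
    ((LinearMap.BilinForm.separatingLeft_toMatrix_iff b).2 hsep)
  simpa only [Fintype.card_fin] using even_card_of_transpose_eq_neg hskew hdet

theorem separatingLeft_restrict_of_isCompl_ker {ω : LinearMap.BilinForm K E} (hω : ω.IsRefl)
    {W : Submodule K E} (hW : IsCompl (LinearMap.ker ω) W) : (ω.restrict W).SeparatingLeft := by
  intro w hw
  have hker : (w : E) ∈ LinearMap.ker ω := by
    refine LinearMap.mem_ker.2 (LinearMap.ext fun y => ?_)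
    obtain ⟨k, hk, w', hw', rfl⟩ := Submodule.mem_sup.1
      (hW.sup_eq_top ▸ Submodule.mem_top : y ∈ LinearMap.ker ω ⊔ W)
    have hwk : ω w k = 0 := hω k w (by rw [LinearMap.mem_ker.1 hk, LinearMap.zero_apply])
    rw [map_add, hwk, zero_add]
    exact hw ⟨w', hw'⟩
  exact Subtype.ext (Submodule.disjoint_def.1 hW.disjoint _ hker w.2)

theorem even_finrank_range_of_isAlt [NeZero (2 : K)] [FiniteDimensional K E]
    {ω : LinearMap.BilinForm K E} (hω : ω.IsAlt) : Even (finrank K (LinearMap.range ω)) := by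
  obtain ⟨W, hW⟩ := Submodule.exists_isCompl (LinearMap.ker ω)
  have heven : Even (finrank K W) :=
    even_finrank_of_isAlt_of_separatingLeft (ω := ω.restrict W) (fun w => hω w)
      (separatingLeft_restrict_of_isCompl_ker hω.isRefl hW)
  have hrange := ω.finrank_range_add_finrank_ker
  have hcompl := Submodule.finrank_add_eq_of_isCompl hW
  rwa [show finrank K (LinearMap.range ω) = finrank K W by omega]

end AlternatingForms

section OrthogonalSubspaces

open Module

variable {K E : Type*} [Field K] [AddCommGroup E] [Module K E] {β : LinearMap.BilinForm K E}

theorem bilinForm_orthogonal_sup (β : LinearMap.BilinForm K E) (A B : Submodule K E) :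
    β.orthogonal (A ⊔ B) = β.orthogonal A ⊓ β.orthogonal B := by
  refine le_antisymm (le_inf (LinearMap.BilinForm.orthogonal_le le_sup_left)
    (LinearMap.BilinForm.orthogonal_le le_sup_right)) ?_
  rintro x ⟨hA, hB⟩ y hy
  obtain ⟨a, ha, b, hb, rfl⟩ := Submodule.mem_sup.1 hy
  have ha0 : β a x = 0 := hA a ha
  have hb0 : β b x = 0 := hB b hb
  change β (a + b) x = 0
  rw [map_add, LinearMap.add_apply, ha0, hb0, add_zero]

theorem ker_le_bilinForm_orthogonal (hβ : β.IsRefl) (W : Submodule K E) :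
    LinearMap.ker β ≤ β.orthogonal W :=
  LinearMap.BilinForm.orthogonal_top_eq_ker hβ ▸ LinearMap.BilinForm.orthogonal_le le_top

variable [FiniteDimensional K E]

theorem finrank_add_finrank_orthogonal_of_ker_le {W : Submodule K E}
    (hW : LinearMap.ker β ≤ W) :
    finrank K W + finrank K (β.orthogonal W) = finrank K E + finrank K (LinearMap.ker β) := by
  rw [LinearMap.BilinForm.finrank_add_finrank_orthogonal', inf_eq_right.2 hW]

theorem orthogonal_orthogonal_of_ker_le (hβ : β.IsRefl) {W : Submodule K E}
    (hW : LinearMap.ker β ≤ W) : β.orthogonal (β.orthogonal W) = W := by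
  refine (Submodule.eq_of_le_of_finrank_eq
    (LinearMap.BilinForm.le_orthogonal_orthogonal hβ) ?_).symm
  have hdim := finrank_add_finrank_orthogonal_of_ker_le hW
  have hdim' := finrank_add_finrank_orthogonal_of_ker_le (ker_le_bilinForm_orthogonal hβ W)
  omega

end OrthogonalSubspaces

/-- The subspace `W` is Lagrangian for the bilinear form `β`: it is its own orthogonal complement.
The form may be degenerate, and `W` then contains its radical. -/
def IsLagrangian {K E : Type*} [Field K] [AddCommGroup E] [Module K E]
    (β : LinearMap.BilinForm K E) (W : Submodule K E) : Prop :=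
  β.orthogonal W = W

theorem exists_linearMap_mem_sub_mem {K E : Type*} [Field K] [AddCommGroup E] [Module K E]
    {B C D : Submodule K E} (hD : D ≤ B ⊔ C) :
    ∃ t : D →ₗ[K] E, (∀ x, t x ∈ B) ∧ ∀ x : D, (x : E) - t x ∈ C := by
  let s := B.subtype.coprod C.subtype
  have hs : LinearMap.range s = B ⊔ C := by
    rw [LinearMap.range_coprod, Submodule.range_subtype, Submodule.range_subtype]
  obtain ⟨g, hg⟩ := Module.projective_lifting_property s.rangeRestrict
    (Submodule.inclusion (hD.trans hs.ge)) s.surjective_rangeRestrict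
  refine ⟨B.subtype ∘ₗ LinearMap.fst K B C ∘ₗ g, fun x => (g x).1.2, fun x => ?_⟩
  have hsum : ((g x).1 : E) + (g x).2 = x :=
    congrArg Subtype.val (LinearMap.congr_fun hg x)
  rw [← hsum]
  simp

namespace IsLagrangian

open Module

variable {K E : Type*} [Field K] [AddCommGroup E] [Module K E] {β : LinearMap.BilinForm K E}
  {A B C W : Submodule K E}

theorem ker_le (hW : IsLagrangian β W) (hβ : β.IsRefl) : LinearMap.ker β ≤ W :=
  (ker_le_bilinForm_orthogonal hβ W).trans_eq hW

theorem apply_eq_zero (hW : IsLagrangian β W) {x y : E} (hx : x ∈ W) (hy : y ∈ W) : β x y = 0 :=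
  hW.ge hy x hx

theorem orthogonal_inf [FiniteDimensional K E] (hA : IsLagrangian β A) (hB : IsLagrangian β B)
    (hβ : β.IsRefl) : β.orthogonal (A ⊓ B) = A ⊔ B := by
  rw [← orthogonal_orthogonal_of_ker_le hβ ((hA.ker_le hβ).trans (le_sup_left : A ≤ A ⊔ B)),
    bilinForm_orthogonal_sup, hA, hB]

theorem two_mul_finrank [FiniteDimensional K E] (hW : IsLagrangian β W) (hβ : β.IsRefl) :
    2 * finrank K W = finrank K E + finrank K (LinearMap.ker β) := by
  rw [← finrank_add_finrank_orthogonal_of_ker_le (hW.ker_le hβ), hW, two_mul]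

theorem orthogonal_inf_sup [FiniteDimensional K E] (hA : IsLagrangian β A) (hB : IsLagrangian β B)
    (hC : IsLagrangian β C) (hβ : β.IsRefl) : β.orthogonal (B ⊓ (A ⊔ C)) = B ⊔ A ⊓ C := by
  rw [← orthogonal_orthogonal_of_ker_le hβ ((hB.ker_le hβ).trans (le_sup_left : B ≤ B ⊔ A ⊓ C)),
    bilinForm_orthogonal_sup, hB, hA.orthogonal_inf hC hβ]

section Splitting

variable {t : ↥(A ⊓ (B ⊔ C)) →ₗ[K] E}

theorem isAlt_compl₂_splitting [NeZero (2 : K)] (hA : IsLagrangian β A) (hB : IsLagrangian β B)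
    (hC : IsLagrangian β C) (hβ : β.IsSymm) (htB : ∀ x, t x ∈ B) (htC : ∀ x, ↑x - t x ∈ C) :
    (β.compl₂ t ∘ₗ (A ⊓ (B ⊔ C)).subtype).IsAlt := by
  intro x
  have hxx := hA.apply_eq_zero x.2.1 x.2.1
  have htt := hB.apply_eq_zero (htB x) (htB x)
  have hzz := hC.apply_eq_zero (htC x) (htC x)
  simp only [map_sub, LinearMap.sub_apply] at hzz
  have hsymm : β (t x) x = β x (t x) := hβ.eq _ _
  have h2 : 2 * β x (t x) = 0 := by linear_combination hxx + htt - hzz - hsymm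
  exact (mul_eq_zero.1 h2).resolve_left two_ne_zero

theorem exists_sub_splitting_mem_inf (htB : ∀ x, t x ∈ B) (htC : ∀ x, ↑x - t x ∈ C) {b : E}
    (hb : b ∈ B ⊓ (A ⊔ C)) : ∃ y, b - t y ∈ B ⊓ C := by
  obtain ⟨hbB, hbAC⟩ := hb
  obtain ⟨a, ha, c, hc, rfl⟩ := Submodule.mem_sup.1 hbAC
  have haBC : a ∈ B ⊔ C :=
    add_sub_cancel_right a c ▸ sub_mem (Submodule.mem_sup_left hbB) (Submodule.mem_sup_right hc)
  refine ⟨⟨a, ha, haBC⟩, sub_mem hbB (htB _), ?_⟩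
  rw [add_sub_right_comm]
  exact add_mem (htC ⟨a, ha, haBC⟩) hc

theorem map_ker_compl₂_splitting [FiniteDimensional K E] (hA : IsLagrangian β A)
    (hB : IsLagrangian β B) (hC : IsLagrangian β C) (hβ : β.IsSymm) (htB : ∀ x, t x ∈ B)
    (htC : ∀ x, ↑x - t x ∈ C) :
    (LinearMap.ker (β.compl₂ t ∘ₗ (A ⊓ (B ⊔ C)).subtype)).map (A ⊓ (B ⊔ C)).subtype =
      A ⊓ B ⊔ A ⊓ C := by
  apply le_antisymm
  · rintro _ ⟨x, hx, rfl⟩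
    have hxt (y) : β x (t y) = 0 := LinearMap.congr_fun (LinearMap.mem_ker.1 hx) y
    have hxBAC : (x : E) ∈ β.orthogonal (B ⊓ (A ⊔ C)) := by
      intro b hb
      obtain ⟨y, hy⟩ := exists_sub_splitting_mem_inf htB htC hb
      have hxy : β (b - t y) x = 0 := (hB.orthogonal_inf hC hβ.isRefl).ge x.2.2 _ hy
      rwa [map_sub, LinearMap.sub_apply, hβ.eq (t y), hxt, sub_zero] at hxy
    rw [hA.orthogonal_inf_sup hB hC hβ.isRefl] at hxBAC
    rw [inf_comm A B, sup_comm, ← sup_inf_assoc_of_le B inf_le_left, sup_comm]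
    exact ⟨hxBAC, x.2.1⟩
  · refine sup_le (fun x ⟨hxA, hxB⟩ => ?_) (fun x ⟨hxA, hxC⟩ => ?_)
    · refine ⟨⟨x, hxA, Submodule.mem_sup_left hxB⟩, LinearMap.ext fun y => ?_, rfl⟩
      exact hB.apply_eq_zero hxB (htB y)
    · refine ⟨⟨x, hxA, Submodule.mem_sup_right hxC⟩, LinearMap.ext fun y => ?_, rfl⟩
      have hxy := hC.apply_eq_zero hxC (htC y)
      rwa [map_sub, hA.apply_eq_zero hxA y.2.1, zero_sub, neg_eq_zero] at hxy

end Splitting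

variable [FiniteDimensional K E]

theorem finrank_inf_sup_modEq [NeZero (2 : K)] (hA : IsLagrangian β A)
    (hB : IsLagrangian β B) (hC : IsLagrangian β C) (hβ : β.IsSymm) :
    finrank K ↥(A ⊓ (B ⊔ C)) ≡ finrank K ↥(A ⊓ B ⊔ A ⊓ C) [MOD 2] := by
  obtain ⟨t, htB, htC⟩ := exists_linearMap_mem_sub_mem (inf_le_right : A ⊓ (B ⊔ C) ≤ B ⊔ C)
  let ω := β.compl₂ t ∘ₗ (A ⊓ (B ⊔ C)).subtype
  have heven := even_finrank_range_of_isAlt (isAlt_compl₂_splitting hA hB hC hβ htB htC)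
  have hker : finrank K (LinearMap.ker ω) = finrank K ↥(A ⊓ B ⊔ A ⊓ C) := by
    rw [← map_ker_compl₂_splitting hA hB hC hβ htB htC, Submodule.finrank_map_subtype_eq]
  rw [← hker, ← ω.finrank_range_add_finrank_ker]
  simpa using (Nat.modEq_zero_iff_dvd.2 heven.two_dvd).add_right (finrank K (LinearMap.ker ω))

theorem finrank_sup_sup_add_finrank_inf_inf (hA : IsLagrangian β A)
    (hB : IsLagrangian β B) (hC : IsLagrangian β C) (hβ : β.IsRefl) :
    finrank K ↥(A ⊔ (B ⊔ C)) + finrank K ↥(A ⊓ (B ⊓ C)) = 2 * finrank K A := by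
  rw [hA.two_mul_finrank hβ, ← finrank_add_finrank_orthogonal_of_ker_le
    ((hA.ker_le hβ).trans (le_sup_left : A ≤ A ⊔ (B ⊔ C))), bilinForm_orthogonal_sup,
    bilinForm_orthogonal_sup, hA, hB, hC]

theorem finrank_inf_add_finrank_inf_add_finrank_inf_modEq [NeZero (2 : K)]
    (hA : IsLagrangian β A) (hB : IsLagrangian β B) (hC : IsLagrangian β C) (hβ : β.IsSymm) :
    finrank K ↥(A ⊓ B) + finrank K ↥(A ⊓ C) + finrank K ↥(B ⊓ C) ≡ finrank K A [MOD 2] := by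
  have hmod : finrank K ↥(A ⊓ (B ⊔ C)) % 2 = finrank K ↥(A ⊓ B ⊔ A ⊓ C) % 2 :=
    finrank_inf_sup_modEq hA hB hC hβ
  have hABC := finrank_sup_sup_add_finrank_inf_inf hA hB hC hβ.isRefl
  have hdimB := hB.two_mul_finrank hβ.isRefl
  have hdimC := hC.two_mul_finrank hβ.isRefl
  have hdimA := hA.two_mul_finrank hβ.isRefl
  have hinf := Submodule.finrank_sup_add_finrank_inf_eq (A ⊓ B) (A ⊓ C)
  rw [← inf_inf_distrib_left] at hinf
  have hsup := Submodule.finrank_sup_add_finrank_inf_eq A (B ⊔ C)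
  have hBC := Submodule.finrank_sup_add_finrank_inf_eq B C
  unfold Nat.ModEq
  omega

end IsLagrangian

/-- Coefficients, all of them non-zero, of linear relations between the four vertices of each
elementary quadrilateral of a net on `ℤ²`. The coefficient `a i j` belongs to the vertex `(i, j)`,
and `b i j`, `c i j`, `d i j` belong to its neighbours `(i + 1, j)`, `(i, j + 1)`,
`(i + 1, j + 1)`. -/
structure QuadCoeffs (K : Type*) [Field K] where
  a : ℤ → ℤ → K
  b : ℤ → ℤ → K
  c : ℤ → ℤ → K
  d : ℤ → ℤ → K
  a_ne_zero : ∀ i j, a i j ≠ 0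
  b_ne_zero : ∀ i j, b i j ≠ 0
  c_ne_zero : ∀ i j, c i j ≠ 0
  d_ne_zero : ∀ i j, d i j ≠ 0

/-- The span of the vertices of the parameter line of `f` with first index `i`. -/
def rowSpan (K : Type*) {M : Type*} [Field K] [AddCommGroup M] [Module K M] (f : ℤ → ℤ → M)
    (i : ℤ) : Submodule K M :=
  Submodule.span K (Set.range (f i))

section RowSpan

variable {K M N : Type*} [Field K] [AddCommGroup M] [Module K M] [AddCommGroup N] [Module K N]

theorem apply_mem_rowSpan (f : ℤ → ℤ → M) (i j : ℤ) : f i j ∈ rowSpan K f i :=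
  Submodule.subset_span ⟨j, rfl⟩

theorem rowSpan_le {f : ℤ → ℤ → M} {i : ℤ} {S : Submodule K M} (h : ∀ j, f i j ∈ S) :
    rowSpan K f i ≤ S :=
  Submodule.span_le.2 (Set.range_subset_iff.2 h)

theorem map_rowSpan (l : M →ₗ[K] N) (f : ℤ → ℤ → M) (i : ℤ) :
    (rowSpan K f i).map l = rowSpan K (fun i j => l (f i j)) i := by
  rw [rowSpan, Submodule.map_span, ← Set.range_comp]
  rfl

theorem iSup_rowSpan_flip (f : ℤ → ℤ → M) : ⨆ j, rowSpan K (flip f) j = ⨆ i, rowSpan K f i :=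
  le_antisymm
    (iSup_le fun j => rowSpan_le fun i => Submodule.mem_iSup_of_mem i (apply_mem_rowSpan f i j))
    (iSup_le fun i => rowSpan_le fun j =>
      Submodule.mem_iSup_of_mem j (apply_mem_rowSpan (flip f) j i))

theorem sup_span_singleton_inf_ker_le {S : Submodule K M} {l : M →ₗ[K] N} {y : M}
    (hy : l y ∉ S.map l) : (S ⊔ Submodule.span K {y}) ⊓ LinearMap.ker l ≤ S := by
  rintro z ⟨hz, hlz⟩
  obtain ⟨s, hs, w, hw, rfl⟩ := Submodule.mem_sup.1 hz
  obtain ⟨t, rfl⟩ := Submodule.mem_span_singleton.1 hw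
  obtain rfl : t = 0 := by
    by_contra ht
    refine hy (((S.map l).smul_mem_iff ht).1 ⟨-s, neg_mem hs, ?_⟩)
    rw [← map_smul, map_neg, neg_eq_iff_add_eq_zero, ← map_add]
    exact hlz
  simpa using hs

theorem disjoint_sup_ker {A B : Submodule K M} {l : M →ₗ[K] N}
    (hA : Disjoint A (LinearMap.ker l)) (hB : Disjoint B (LinearMap.ker l))
    (hAB : A.map l ⊓ B.map l ≤ (A ⊓ B).map l) : Disjoint (A ⊔ B) (LinearMap.ker l) := by
  rw [Submodule.disjoint_def] at *
  intro z hz hlz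
  obtain ⟨x, hx, y, hy, rfl⟩ := Submodule.mem_sup.1 hz
  have hxy : l x = -l y := eq_neg_of_add_eq_zero_left ((map_add l x y).symm.trans hlz)
  obtain ⟨w, ⟨hwA, hwB⟩, hw⟩ := hAB ⟨⟨x, hx, rfl⟩, ⟨-y, neg_mem hy, by rw [map_neg, hxy]⟩⟩
  have hxw : x - w = 0 := hA _ (sub_mem hx hwA) (by rw [LinearMap.mem_ker, map_sub, hw, sub_self])
  have hyw : y + w = 0 := hB _ (add_mem hy hwB) (by
    rw [LinearMap.mem_ker, map_add, hw, hxy, add_neg_cancel])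
  rw [sub_eq_zero.1 hxw, add_comm, hyw]

theorem mem_sup_span_singleton_of_forall_smul_add_smul_mem {S : Submodule K M} {x : ℤ → M}
    {u v : ℤ → K} (hu : ∀ j, u j ≠ 0) (hv : ∀ j, v j ≠ 0)
    (h : ∀ j, u j • x j + v j • x (j + 1) ∈ S) (j k : ℤ) : x k ∈ S ⊔ Submodule.span K {x j} := by
  set T := S ⊔ Submodule.span K {x j}
  have hT (j) : u j • x j + v j • x (j + 1) ∈ T := Submodule.mem_sup_left (h j)
  induction k using Int.inductionOn' (b := j) with
  | zero => exact Submodule.mem_sup_right (Submodule.mem_span_singleton_self _)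
  | succ k _ ih =>
    exact (T.smul_mem_iff (hv k)).1 ((T.add_mem_iff_right (T.smul_mem (u k) ih)).1 (hT k))
  | pred k _ ih =>
    have hk := hT (k - 1)
    rw [sub_add_cancel, T.add_mem_iff_left (T.smul_mem _ ih)] at hk
    exact (T.smul_mem_iff (hu _)).1 hk

end RowSpan

namespace QuadCoeffs

variable {K M N : Type*} [Field K] [AddCommGroup M] [Module K M] [AddCommGroup N] [Module K N]
  {g : QuadCoeffs K} {f : ℤ → ℤ → M}

/-- The coefficients after the two directions of the net are interchanged. -/
def swap (g : QuadCoeffs K) : QuadCoeffs K where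
  a := flip g.a
  b := flip g.c
  c := flip g.b
  d := flip g.d
  a_ne_zero i j := g.a_ne_zero j i
  b_ne_zero i j := g.c_ne_zero j i
  c_ne_zero i j := g.b_ne_zero j i
  d_ne_zero i j := g.d_ne_zero j i

/-- The linear combination with coefficients `g` of the vertices of an elementary quadrilateral. -/
def quadSum (g : QuadCoeffs K) (f : ℤ → ℤ → M) (i j : ℤ) : M :=
  g.a i j • f i j + g.b i j • f (i + 1) j + g.c i j • f i (j + 1) + g.d i j • f (i + 1) (j + 1)

/-- `f` is a Q-net, in the sense that the vertices of each of its elementary quadrilaterals satisfy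
the linear relation with coefficients `g`. -/
def IsNet (g : QuadCoeffs K) (f : ℤ → ℤ → M) : Prop :=
  ∀ i j, g.quadSum f i j = 0

theorem map_quadSum (g : QuadCoeffs K) (l : M →ₗ[K] N) (f : ℤ → ℤ → M) (i j : ℤ) :
    l (g.quadSum f i j) = g.quadSum (fun i j => l (f i j)) i j := by
  simp only [quadSum, map_add, map_smul]

theorem swap_quadSum_flip (g : QuadCoeffs K) (f : ℤ → ℤ → M) (i j : ℤ) :
    g.swap.quadSum (flip f) i j = g.quadSum f j i := by
  simp only [quadSum, swap, flip, add_right_comm]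

namespace IsNet

theorem flip_swap (h : g.IsNet f) : g.swap.IsNet (flip f) := fun i j =>
  (g.swap_quadSum_flip f i j).trans (h j i)

theorem map (h : g.IsNet f) (l : M →ₗ[K] N) : g.IsNet fun i j => l (f i j) := fun i j => by
  rw [← map_quadSum, h i j, map_zero]

theorem prodMk {f' : ℤ → ℤ → N} (h : g.IsNet f) (h' : g.IsNet f') :
    g.IsNet fun i j => (f i j, f' i j) := fun i j =>
  Prod.ext ((g.map_quadSum (LinearMap.fst K M N) (fun i j => (f i j, f' i j)) i j).trans (h i j))
    ((g.map_quadSum (LinearMap.snd K M N) (fun i j => (f i j, f' i j)) i j).trans (h' i j))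

theorem edge_eq_neg (h : g.IsNet f) (i j : ℤ) :
    g.a i j • f i j + g.c i j • f i (j + 1) =
      -(g.b i j • f (i + 1) j + g.d i j • f (i + 1) (j + 1)) := by
  rw [eq_neg_iff_add_eq_zero, ← h i j, quadSum]
  abel

theorem edge_mem (h : g.IsNet f) (i j : ℤ) :
    g.a i j • f i j + g.c i j • f i (j + 1) ∈ rowSpan K f i ⊓ rowSpan K f (i + 1) := by
  refine ⟨add_mem (Submodule.smul_mem _ _ (apply_mem_rowSpan f i _))
    (Submodule.smul_mem _ _ (apply_mem_rowSpan f i _)), ?_⟩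
  rw [h.edge_eq_neg]
  exact neg_mem (add_mem (Submodule.smul_mem _ _ (apply_mem_rowSpan f _ _))
    (Submodule.smul_mem _ _ (apply_mem_rowSpan f _ _)))

theorem edge_succ_mem (h : g.IsNet f) (i j : ℤ) :
    g.b i j • f (i + 1) j + g.d i j • f (i + 1) (j + 1) ∈
      rowSpan K f i ⊓ rowSpan K f (i + 1) := by
  rw [← neg_mem_iff, ← h.edge_eq_neg]
  exact h.edge_mem i j

theorem rowSpan_le_sup (h : g.IsNet f) (i j : ℤ) :
    rowSpan K f i ≤ rowSpan K f i ⊓ rowSpan K f (i + 1) ⊔ Submodule.span K {f i j} :=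
  rowSpan_le (mem_sup_span_singleton_of_forall_smul_add_smul_mem (g.a_ne_zero i) (g.c_ne_zero i)
    (h.edge_mem i) j)

theorem rowSpan_succ_le_sup (h : g.IsNet f) (i j : ℤ) :
    rowSpan K f (i + 1) ≤
      rowSpan K f i ⊓ rowSpan K f (i + 1) ⊔ Submodule.span K {f (i + 1) j} :=
  rowSpan_le (mem_sup_span_singleton_of_forall_smul_add_smul_mem (g.b_ne_zero i) (g.d_ne_zero i)
    (h.edge_succ_mem i) j)

theorem rowSpan_le_sup_rowSpan_flip (h : g.IsNet f) (i j k : ℤ) :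
    rowSpan K f k ≤ rowSpan K f i ⊔ rowSpan K (flip f) j := by
  have hcol (k) : Submodule.span K {f k j} ≤ rowSpan K f i ⊔ rowSpan K (flip f) j :=
    ((Submodule.span_singleton_le_iff_mem _ _).2 (apply_mem_rowSpan (flip f) j k)).trans
      le_sup_right
  induction k using Int.inductionOn' (b := i) with
  | zero => exact le_sup_left
  | succ k _ ih =>
    exact (h.rowSpan_succ_le_sup k j).trans (sup_le (inf_le_left.trans ih) (hcol _))
  | pred k _ ih =>
    have hk := h.rowSpan_le_sup (k - 1) j
    rw [sub_add_cancel] at hk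
    exact hk.trans (sup_le (inf_le_right.trans ih) (hcol _))

theorem rowSpan_sup_rowSpan_flip_eq_top (h : g.IsNet f) (htop : ⨆ i, rowSpan K f i = ⊤)
    (i j : ℤ) : rowSpan K f i ⊔ rowSpan K (flip f) j = ⊤ :=
  top_le_iff.1 (htop.ge.trans (iSup_le (h.rowSpan_le_sup_rowSpan_flip i j)))

theorem rowSpan_inf_rowSpan_flip_le [FiniteDimensional K M] (h : g.IsNet f)
    (htop : ⨆ i, rowSpan K f i = ⊤) {i j : ℤ} (hij : f i j ≠ 0)
    (hdim : Module.finrank K (rowSpan K f i) + Module.finrank K (rowSpan K (flip f) j) =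
      Module.finrank K M + 1) :
    rowSpan K f i ⊓ rowSpan K (flip f) j ≤ Submodule.span K {f i j} := by
  have hle : Submodule.span K {f i j} ≤ rowSpan K f i ⊓ rowSpan K (flip f) j :=
    (Submodule.span_singleton_le_iff_mem _ _).2
      ⟨apply_mem_rowSpan f i j, apply_mem_rowSpan (flip f) j i⟩
  have hsum := Submodule.finrank_sup_add_finrank_inf_eq (rowSpan K f i) (rowSpan K (flip f) j)
  rw [h.rowSpan_sup_rowSpan_flip_eq_top htop, finrank_top, hdim] at hsum
  refine (Submodule.eq_of_le_of_finrank_le hle ?_).ge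
  rw [finrank_span_singleton hij]
  omega

theorem rowSpan_inf_ker_le_rowSpan (h : g.IsNet f) {l : M →ₗ[K] N}
    (hl : ∀ i, ∃ j, l (f i j) ∉ (rowSpan K f (i + 1)).map l)
    (hl' : ∀ i, ∃ j, l (f (i + 1) j) ∉ (rowSpan K f i).map l) (i k : ℤ) :
    rowSpan K f i ⊓ LinearMap.ker l ≤ rowSpan K f k := by
  induction k using Int.inductionOn' (b := i) with
  | zero => exact inf_le_left
  | succ k _ ih =>
    obtain ⟨j, hj⟩ := hl k
    exact (le_inf (ih.trans ((h.rowSpan_le_sup k j).trans (sup_le_sup_right inf_le_right _)))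
      inf_le_right).trans (sup_span_singleton_inf_ker_le hj)
  | pred k _ ih =>
    obtain ⟨j, hj⟩ := hl' (k - 1)
    have hk := h.rowSpan_succ_le_sup (k - 1) j
    rw [sub_add_cancel] at hj hk
    exact (le_inf (ih.trans (hk.trans (sup_le_sup_right inf_le_left _)))
      inf_le_right).trans (sup_span_singleton_inf_ker_le hj)

end IsNet

end QuadCoeffs

section QuadraticForms

variable {K E : Type*} [Field K] [AddCommGroup E] [Module K E]

theorem polarBilin_comm (Q : QuadraticForm K E) (x y : E) :
    Q.polarBilin x y = Q.polarBilin y x :=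
  QuadraticMap.polar_comm Q x y

theorem isSymm_polarBilin (Q : QuadraticForm K E) :
    LinearMap.BilinForm.IsSymm Q.polarBilin :=
  ⟨polarBilin_comm Q⟩

theorem map_smul_add_smul_of_map_eq_zero (Q : QuadraticForm K E) {x y : E} (hx : Q x = 0)
    (hy : Q y = 0) (a b : K) : Q (a • x + b • y) = a * b * Q.polarBilin x y := by
  rw [QuadraticMap.map_add Q, QuadraticMap.map_smul, QuadraticMap.map_smul, hx, hy,
    ← QuadraticMap.polarBilin_apply_apply, map_smul, map_smul, LinearMap.smul_apply]
  simp only [smul_eq_mul]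
  ring

theorem polarBilin_eq_zero_of_forall_mem {Q : QuadraticForm K E} {W : Submodule K E}
    (hW : ∀ x ∈ W, Q x = 0) {x y : E} (hx : x ∈ W) (hy : y ∈ W) : Q.polarBilin x y = 0 := by
  rw [QuadraticMap.polarBilin_apply_apply, QuadraticMap.polar, hW _ (add_mem hx hy), hW _ hx,
    hW _ hy, sub_zero, sub_zero]

theorem mul_polarBilin_eq_mul_polarBilin_of_sum_eq_zero (Q : QuadraticForm K E) {x y z w : E}
    (hx : Q x = 0) (hy : Q y = 0) (hz : Q z = 0) (hw : Q w = 0) {a b c d : K}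
    (h : a • x + b • y + c • z + d • w = 0) :
    a * b * Q.polarBilin x y = c * d * Q.polarBilin z w := by
  rw [add_assoc] at h
  rw [← map_smul_add_smul_of_map_eq_zero Q hx hy, ← map_smul_add_smul_of_map_eq_zero Q hz hw,
    eq_neg_of_add_eq_zero_left h, QuadraticMap.map_neg]

theorem exists_linearMap_eq_of_disjoint_ker_fst {F : Type*} [AddCommGroup F] [Module K F]
    {Γ : Submodule K (E × F)} (hdisj : Disjoint Γ (LinearMap.ker (LinearMap.fst K E F)))
    (htop : Γ.map (LinearMap.fst K E F) = ⊤) : ∃ Φ : E →ₗ[K] F, ∀ z ∈ Γ, Φ z.1 = z.2 := by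
  have hbij : Function.Bijective (Prod.fst ∘ Γ.subtype) := by
    constructor
    · exact LinearMap.injective_domRestrict_iff.2 hdisj
    · intro x
      obtain ⟨z, hz, hzx⟩ := htop.ge (Submodule.mem_top (x := x))
      exact ⟨⟨z, hz⟩, hzx⟩
  obtain ⟨Φ, hΦ⟩ := Submodule.exists_eq_graph hbij
  refine ⟨Φ, fun z hz => ?_⟩
  rw [hΦ, LinearMap.mem_graph_iff] at hz
  exact hz.symm

end QuadraticForms

/-- A Q-net of vectors `p` inscribed in the quadric of `Q`, whose edges span non-isotropic lines,
whose vertices span the whole space, and in which parameter lines of different directions have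
spans that meet only in their common vertex. -/
structure InscribedNet (K E : Type*) [Field K] [AddCommGroup E] [Module K E] where
  coeffs : QuadCoeffs K
  Q : QuadraticForm K E
  p : ℤ → ℤ → E
  isNet : coeffs.IsNet p
  isotropic : ∀ i j, Q (p i j) = 0
  polar_row : ∀ i j, Q.polarBilin (p i j) (p i (j + 1)) ≠ 0
  polar_col : ∀ i j, Q.polarBilin (p i j) (p (i + 1) j) ≠ 0
  rowSpan_inf_le : ∀ i j, rowSpan K p i ⊓ rowSpan K (flip p) j ≤ Submodule.span K {p i j}
  iSup_rowSpan : ⨆ i, rowSpan K p i = ⊤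

namespace InscribedNet

open Module

variable {K E : Type*} [Field K] [AddCommGroup E] [Module K E]

/-- The inscribed net with its two directions interchanged. -/
def swap (N : InscribedNet K E) : InscribedNet K E where
  coeffs := N.coeffs.swap
  Q := N.Q
  p := flip N.p
  isNet := N.isNet.flip_swap
  isotropic i j := N.isotropic j i
  polar_row i j := N.polar_col j i
  polar_col i j := N.polar_row j i
  rowSpan_inf_le i j := inf_comm (rowSpan K N.p j) _ ▸ N.rowSpan_inf_le j i
  iSup_rowSpan := (iSup_rowSpan_flip N.p).trans N.iSup_rowSpan

/-- The span of the parameter line `i` of the first direction. -/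
def V (N : InscribedNet K E) (i : ℤ) : Submodule K E := rowSpan K N.p i

/-- The span of the parameter line `j` of the second direction. -/
def H (N : InscribedNet K E) (j : ℤ) : Submodule K E := N.swap.V j

variable (N : InscribedNet K E)

theorem mem_V (i j : ℤ) : N.p i j ∈ N.V i := apply_mem_rowSpan N.p i j

theorem mem_H (i j : ℤ) : N.p i j ∈ N.H j := N.swap.mem_V j i

theorem V_le_sup (i j : ℤ) : N.V i ≤ N.V i ⊓ N.V (i + 1) ⊔ Submodule.span K {N.p i j} :=
  N.isNet.rowSpan_le_sup i j

theorem V_sup_H (i j : ℤ) : N.V i ⊔ N.H j = ⊤ :=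
  N.isNet.rowSpan_sup_rowSpan_flip_eq_top N.iSup_rowSpan i j

theorem polarBilin_eq_zero_of_mem_V_inf_H {i j : ℤ} {x : E} (hx : x ∈ N.V i ⊓ N.H j) :
    N.Q.polarBilin (N.p i j) x = 0 := by
  obtain ⟨t, rfl⟩ := Submodule.mem_span_singleton.1 (N.rowSpan_inf_le i j hx)
  rw [map_smul, QuadraticMap.polarBilin_apply_apply, QuadraticMap.polar_self, N.isotropic,
    smul_zero, smul_zero]

theorem notMem_V_succ (i j : ℤ) : N.p i j ∉ N.V (i + 1) := fun h =>
  N.polar_col i j ((polarBilin_comm N.Q _ _).trans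
    (N.polarBilin_eq_zero_of_mem_V_inf_H ⟨h, N.mem_H i j⟩))

theorem succ_notMem_V (i j : ℤ) : N.p (i + 1) j ∉ N.V i := fun h =>
  N.polar_col i j (N.polarBilin_eq_zero_of_mem_V_inf_H ⟨h, N.mem_H (i + 1) j⟩)

/-- A splitting of the functionals polar to the vertices: `φ i j` vanishes on `V i` and agrees with
the polar of `p i j` on `H j`. -/
structure IsSplitting (φ : ℤ → ℤ → Dual K E) : Prop where
  apply_V : ∀ i j, ∀ x ∈ N.V i, φ i j x = 0
  apply_H : ∀ i j, ∀ x ∈ N.H j, φ i j x = N.Q.polarBilin (N.p i j) x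

/-- The lift of the net to `E × E*` that is defined by functionals `φ i j` at its vertices. -/
def lift (φ : ℤ → ℤ → Dual K E) (i j : ℤ) : E × Dual K E := (N.p i j, φ i j)

theorem exists_isSplitting : ∃ φ, N.IsSplitting φ := by
  have h (i j) : ∃ φ : Dual K E, (∀ x ∈ N.V i, φ x = 0) ∧
      ∀ x ∈ N.H j, φ x = N.Q.polarBilin (N.p i j) x := by
    have hmem : N.Q.polarBilin (N.p i j) ∈
        (N.V i).dualAnnihilator ⊔ (N.H j).dualAnnihilator := by
      rw [← Subspace.dualAnnihilator_inf_eq, Submodule.mem_dualAnnihilator]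
      exact fun x => N.polarBilin_eq_zero_of_mem_V_inf_H
    obtain ⟨φ, hφ, ψ, hψ, hsum⟩ := Submodule.mem_sup.1 hmem
    refine ⟨φ, (Submodule.mem_dualAnnihilator φ).1 hφ, fun x hx => ?_⟩
    rw [← hsum, LinearMap.add_apply, (Submodule.mem_dualAnnihilator ψ).1 hψ x hx, add_zero]
  choose φ hφV hφH using h
  exact ⟨φ, hφV, hφH⟩

namespace IsSplitting

variable {N} {φ : ℤ → ℤ → Dual K E}

theorem swap (hφ : N.IsSplitting φ) :
    N.swap.IsSplitting (flip fun i j => N.Q.polarBilin (N.p i j) - φ i j) where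
  apply_V i j x hx := by
    rw [flip, LinearMap.sub_apply, hφ.apply_H j i x hx, sub_self]
  apply_H i j x hx := by
    rw [flip, LinearMap.sub_apply, hφ.apply_V j i x hx, sub_zero]
    rfl

theorem quadSum_apply_self (hφ : N.IsSplitting φ) (i j : ℤ) :
    N.coeffs.quadSum φ i j (N.p i j) = 0 := by
  have hnet := N.isNet.map (φ (i + 1) (j + 1)) i j
  have hopp := mul_polarBilin_eq_mul_polarBilin_of_sum_eq_zero N.Q (N.isotropic _ _)
    (N.isotropic _ _) (N.isotropic _ _) (N.isotropic _ _) (N.isNet i j)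
  simp only [QuadCoeffs.quadSum, smul_eq_mul, hφ.apply_V _ _ _ (N.mem_V (i + 1) _),
    hφ.apply_H _ _ _ (N.mem_H i (j + 1))] at hnet
  simp only [QuadCoeffs.quadSum, LinearMap.add_apply, LinearMap.smul_apply, smul_eq_mul,
    hφ.apply_V i _ _ (N.mem_V i j), hφ.apply_H (i + 1) j _ (N.mem_H i j)]
  rw [polarBilin_comm N.Q (N.p (i + 1) (j + 1))] at hnet
  rw [polarBilin_comm N.Q (N.p (i + 1) j)]
  refine (mul_eq_zero.1 ?_).resolve_left (N.coeffs.a_ne_zero i j)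
  linear_combination N.coeffs.d i j * hnet + hopp

theorem V_le_ker_quadSum (hφ : N.IsSplitting φ) (i j : ℤ) :
    N.V i ≤ LinearMap.ker (N.coeffs.quadSum φ i j) := by
  refine (N.V_le_sup i j).trans (sup_le (fun x hx => ?_) ?_)
  · simp only [LinearMap.mem_ker, QuadCoeffs.quadSum, LinearMap.add_apply, LinearMap.smul_apply,
      hφ.apply_V i _ x hx.1, hφ.apply_V (i + 1) _ x hx.2, smul_zero, add_zero]
  · exact (Submodule.span_singleton_le_iff_mem _ _).2 (hφ.quadSum_apply_self i j)

theorem H_le_ker_quadSum (hφ : N.IsSplitting φ) (i j : ℤ) :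
    N.H j ≤ LinearMap.ker (N.coeffs.quadSum φ i j) := by
  have hsub : N.coeffs.quadSum (fun i j => N.Q.polarBilin (N.p i j) - φ i j) i j =
      -N.coeffs.quadSum φ i j := by
    rw [← zero_sub, ← N.isNet.map N.Q.polarBilin i j]
    simp only [QuadCoeffs.quadSum, smul_sub]
    abel
  have hswap := hφ.swap.V_le_ker_quadSum j i
  rwa [show N.swap.coeffs = N.coeffs.swap from rfl, QuadCoeffs.swap_quadSum_flip, hsub,
    LinearMap.ker_neg] at hswap

theorem isNet (hφ : N.IsSplitting φ) : N.coeffs.IsNet φ := fun i j => by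
  rw [← LinearMap.ker_eq_top, ← top_le_iff, ← N.V_sup_H i j]
  exact sup_le (hφ.V_le_ker_quadSum i j) (hφ.H_le_ker_quadSum i j)

theorem isNet_lift (hφ : N.IsSplitting φ) : N.coeffs.IsNet (N.lift φ) := N.isNet.prodMk hφ.isNet

theorem disjoint_rowSpan_lift_ker_fst (hφ : N.IsSplitting φ) (i : ℤ) :
    Disjoint (rowSpan K (N.lift φ) i) (LinearMap.ker (LinearMap.fst K E (Dual K E))) := by
  rw [Submodule.disjoint_def]
  rintro ⟨x, θ⟩ hz (rfl : x = 0)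
  have hmap (k) : (rowSpan K (N.lift φ) k).map (LinearMap.fst K E (Dual K E)) = N.V k :=
    map_rowSpan _ _ k
  have hk (k) : ((0 : E), θ) ∈ rowSpan K (N.lift φ) k :=
    hφ.isNet_lift.rowSpan_inf_ker_le_rowSpan
      (fun i => ⟨0, (hmap (i + 1)).symm ▸ N.notMem_V_succ i 0⟩)
      (fun i => ⟨0, (hmap i).symm ▸ N.succ_notMem_V i 0⟩) i k ⟨hz, LinearMap.mem_ker.2 rfl⟩
  have hθ (k) : θ ∈ (N.V k).dualAnnihilator :=
    rowSpan_le (f := N.lift φ) (S := (N.V k).dualAnnihilator.comap (LinearMap.snd K E (Dual K E)))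
      (fun j => (Submodule.mem_dualAnnihilator _).2 (hφ.apply_V k j)) (hk k)
  have hθ' : θ ∈ (⨆ k, N.V k).dualAnnihilator := by
    rw [Submodule.dualAnnihilator_iSup_eq]
    exact (Submodule.mem_iInf _).2 hθ
  rw [show ⨆ k, N.V k = ⊤ from N.iSup_rowSpan, Submodule.dualAnnihilator_top] at hθ'
  rw [(Submodule.mem_bot K).1 hθ']
  rfl

theorem disjoint_rowSpan_flip_lift_ker_fst (hφ : N.IsSplitting φ) (j : ℤ) :
    Disjoint (rowSpan K (flip (N.lift φ)) j) (LinearMap.ker (LinearMap.fst K E (Dual K E))) := by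
  let l : E × Dual K E →ₗ[K] E × Dual K E := (LinearMap.fst K E (Dual K E)).prod
    (N.Q.polarBilin ∘ₗ LinearMap.fst K E (Dual K E) - LinearMap.snd K E (Dual K E))
  rw [Submodule.disjoint_def]
  rintro ⟨x, θ⟩ hz (rfl : x = 0)
  have hlz := (map_rowSpan l (flip (N.lift φ)) j).le (Submodule.mem_map_of_mem hz)
  have hlz0 : l (0, θ) = 0 :=
    Submodule.disjoint_def.1 (hφ.swap.disjoint_rowSpan_lift_ker_fst j) _ hlz rfl
  have hθ : N.Q.polarBilin 0 - θ = 0 := congrArg Prod.snd hlz0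
  rw [map_zero, zero_sub, neg_eq_zero] at hθ
  rw [hθ]
  rfl

theorem exists_linearMap_apply_eq (hφ : N.IsSplitting φ) :
    ∃ Φ : E →ₗ[K] Dual K E, ∀ i j, Φ (N.p i j) = φ i j := by
  let A := rowSpan K (N.lift φ) 0
  let B := rowSpan K (flip (N.lift φ)) 0
  have hA : A.map (LinearMap.fst K E (Dual K E)) = N.V 0 := map_rowSpan _ _ 0
  have hB : B.map (LinearMap.fst K E (Dual K E)) = N.H 0 := map_rowSpan _ _ 0
  have hAB : A.map (LinearMap.fst K E (Dual K E)) ⊓ B.map (LinearMap.fst K E (Dual K E)) ≤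
      (A ⊓ B).map (LinearMap.fst K E (Dual K E)) := by
    rw [hA, hB]
    refine (N.rowSpan_inf_le 0 0).trans ((Submodule.span_singleton_le_iff_mem _ _).2 ?_)
    exact ⟨N.lift φ 0 0, ⟨apply_mem_rowSpan _ 0 0, apply_mem_rowSpan (flip (N.lift φ)) 0 0⟩, rfl⟩
  obtain ⟨Φ, hΦ⟩ := exists_linearMap_eq_of_disjoint_ker_fst
    (disjoint_sup_ker (hφ.disjoint_rowSpan_lift_ker_fst 0)
      (hφ.disjoint_rowSpan_flip_lift_ker_fst 0) hAB)
    (by rw [Submodule.map_sup, hA, hB, N.V_sup_H])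
  exact ⟨Φ, fun i j => hΦ (N.lift φ i j)
    (hφ.isNet_lift.rowSpan_le_sup_rowSpan_flip 0 0 i (apply_mem_rowSpan (N.lift φ) i j))⟩

end IsSplitting

/-- The quadratic form of the net is the sum of a form `𝒱` that vanishes on all subspaces `V i` and
a form `ℋ` that vanishes on all subspaces `H j`. -/
structure IsDecomposition (𝒱 ℋ : QuadraticForm K E) : Prop where
  add_eq : 𝒱 + ℋ = N.Q
  apply_V : ∀ i, ∀ x ∈ N.V i, 𝒱 x = 0
  apply_H : ∀ j, ∀ x ∈ N.H j, ℋ x = 0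

theorem exists_isDecomposition [NeZero (2 : K)] : ∃ 𝒱 ℋ, N.IsDecomposition 𝒱 ℋ := by
  obtain ⟨φ, hφ⟩ := N.exists_isSplitting
  obtain ⟨Φ, hΦ⟩ := hφ.exists_linearMap_apply_eq
  let 𝒱 : QuadraticForm K E := (2⁻¹ : K) • LinearMap.BilinMap.toQuadraticMap Φ
  have h𝒱 (x : E) : 𝒱 x = 2⁻¹ * Φ x x := rfl
  refine ⟨𝒱, N.Q - 𝒱, add_sub_cancel _ _, fun i x hx => ?_, fun j x hx => ?_⟩
  · have hker : N.V i ≤ LinearMap.ker (LinearMap.flip Φ x) := rowSpan_le fun j => by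
      rw [LinearMap.mem_ker, LinearMap.flip_apply, hΦ, hφ.apply_V i j x hx]
    rw [h𝒱, show Φ x x = 0 from hker hx, mul_zero]
  · have heq : N.H j ≤ LinearMap.eqLocus (LinearMap.flip Φ x) (LinearMap.flip N.Q.polarBilin x) :=
      rowSpan_le fun i => by
        simp only [LinearMap.mem_eqLocus, LinearMap.flip_apply]
        exact (congrArg (· x) (hΦ i j)).trans (hφ.apply_H i j x hx)
    have hxx : Φ x x = 2 • N.Q x := (heq hx).trans (QuadraticMap.polar_self N.Q x)
    rw [sub_apply, h𝒱, hxx, two_nsmul, ← two_mul,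
      inv_mul_cancel_left₀ two_ne_zero, sub_self]

end InscribedNet

section Isotropic

open Module

variable {K E : Type*} [Field K] [AddCommGroup E] [Module K E] {β : LinearMap.BilinForm K E}
  {W : Submodule K E}

theorem le_orthogonal_polarBilin_of_forall_mem {Q : QuadraticForm K E}
    (hW : ∀ x ∈ W, Q x = 0) : W ≤ LinearMap.BilinForm.orthogonal Q.polarBilin W :=
  fun _ hy _ hx => polarBilin_eq_zero_of_forall_mem hW hx hy

variable [FiniteDimensional K E]

theorem two_mul_finrank_le_of_le_orthogonal (hW : W ≤ β.orthogonal W) :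
    2 * finrank K W ≤ finrank K E + finrank K (LinearMap.ker β) := by
  have hdim := LinearMap.BilinForm.finrank_add_finrank_orthogonal' (B := β) W
  have hle := Submodule.finrank_mono hW
  have hinf := Submodule.finrank_mono (inf_le_right : W ⊓ LinearMap.ker β ≤ LinearMap.ker β)
  omega

theorem isLagrangian_of_le_two_mul_finrank (hW : W ≤ β.orthogonal W)
    (hdim : finrank K E + finrank K ↥(W ⊓ LinearMap.ker β) ≤ 2 * finrank K W) :
    IsLagrangian β W := by
  refine (Submodule.eq_of_le_of_finrank_le hW ?_).symm
  have horth := LinearMap.BilinForm.finrank_add_finrank_orthogonal' (B := β) W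
  omega

end Isotropic

namespace InscribedNet

open Module

variable {K E : Type*} [Field K] [AddCommGroup E] [Module K E] {N : InscribedNet K E}
  {𝒱 ℋ : QuadraticForm K E}

theorem finrank_V_eq_finrank_inf_succ_add_one [FiniteDimensional K E] (N : InscribedNet K E)
    (i : ℤ) : finrank K (N.V i) = finrank K ↥(N.V i ⊓ N.V (i + 1)) + 1 := by
  have hsup : N.V i ⊓ N.V (i + 1) ⊔ Submodule.span K {N.p i 0} = N.V i :=
    le_antisymm
      (sup_le inf_le_left ((Submodule.span_singleton_le_iff_mem _ _).2 (N.mem_V i 0)))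
      (N.V_le_sup i 0)
  have hp : N.p i 0 ∉ N.V i ⊓ N.V (i + 1) := fun h => N.notMem_V_succ i 0 h.2
  rw [← Submodule.finrank_sup_span_singleton hp, hsup]

namespace IsDecomposition

theorem swap (h : N.IsDecomposition 𝒱 ℋ) : N.swap.IsDecomposition ℋ 𝒱 where
  add_eq := (add_comm ℋ 𝒱).trans h.add_eq
  apply_V := h.apply_H
  apply_H := h.apply_V

theorem polarBilin_ne_zero (h : N.IsDecomposition 𝒱 ℋ) (i j : ℤ) :
    𝒱.polarBilin (N.p i j) (N.p (i + 1) j) ≠ 0 := by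
  have hℋ := polarBilin_eq_zero_of_forall_mem (h.apply_H j) (N.mem_H i j) (N.mem_H (i + 1) j)
  have hQ := N.polar_col i j
  rw [QuadraticMap.polarBilin_apply_apply] at hℋ hQ ⊢
  rwa [← h.add_eq, FunLike.coe_add, QuadraticMap.polar_add, hℋ, add_zero] at hQ

theorem V_inf_ker_le_V_succ (h : N.IsDecomposition 𝒱 ℋ) (i : ℤ) :
    N.V i ⊓ LinearMap.ker 𝒱.polarBilin ≤ N.V (i + 1) := by
  let l := 𝒱.polarBilin (N.p (i + 1) 0)
  have hker : LinearMap.ker 𝒱.polarBilin ≤ LinearMap.ker l := fun x hx => by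
    rw [LinearMap.mem_ker, polarBilin_comm, LinearMap.mem_ker.1 hx, LinearMap.zero_apply]
  have hl : l (N.p i 0) ∉ (N.V i ⊓ N.V (i + 1)).map l := by
    rintro ⟨x, hx, hxl⟩
    rw [polarBilin_eq_zero_of_forall_mem (h.apply_V (i + 1)) (N.mem_V (i + 1) 0) hx.2] at hxl
    exact h.polarBilin_ne_zero i 0 ((polarBilin_comm 𝒱 _ _).trans hxl.symm)
  exact (inf_le_inf (N.V_le_sup i 0) hker).trans
    ((sup_span_singleton_inf_ker_le hl).trans inf_le_right)

theorem V_inf_ker_le_V_add (h : N.IsDecomposition 𝒱 ℋ) (i : ℤ) (k : ℕ) :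
    N.V i ⊓ LinearMap.ker 𝒱.polarBilin ≤ N.V (i + k) := by
  induction k with
  | zero => simp
  | succ k ih =>
    rw [Nat.cast_succ, ← add_assoc]
    exact (le_inf ih inf_le_right).trans (h.V_inf_ker_le_V_succ (i + k))

theorem finrank_ker_polarBilin [FiniteDimensional K E] (h : N.IsDecomposition 𝒱 ℋ) {m : ℕ}
    {i : ℤ} (hE : finrank K E = 2 * m + 1) (hV : finrank K (N.V i) = m + 1)
    (hinf : finrank K ↥(⨅ k : Fin (m + 1), N.V (i + (k : ℕ))) = 1) :
    finrank K (LinearMap.ker 𝒱.polarBilin) = 1 := by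
  have hle : finrank K ↥(N.V i ⊓ LinearMap.ker 𝒱.polarBilin) ≤ 1 :=
    hinf ▸ Submodule.finrank_mono (le_iInf fun k : Fin (m + 1) => h.V_inf_ker_le_V_add i k)
  have hlag : IsLagrangian 𝒱.polarBilin (N.V i) :=
    isLagrangian_of_le_two_mul_finrank (le_orthogonal_polarBilin_of_forall_mem (h.apply_V i))
      (by omega)
  have hdim := hlag.two_mul_finrank (isSymm_polarBilin 𝒱).isRefl
  omega

theorem exists_mem_H_apply_ne_zero (h : N.IsDecomposition 𝒱 ℋ) (j : ℤ) :
    ∃ x ∈ N.H j, 𝒱 x ≠ 0 := by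
  refine ⟨N.p 0 j + N.p (0 + 1) j, add_mem (N.mem_H 0 j) (N.mem_H (0 + 1) j), ?_⟩
  rw [QuadraticMap.map_add 𝒱, h.apply_V _ _ (N.mem_V 0 j), h.apply_V _ _ (N.mem_V (0 + 1) j),
    add_zero, zero_add]
  exact h.polarBilin_ne_zero 0 j

theorem linearIndependent (h : N.IsDecomposition 𝒱 ℋ) : LinearIndependent K ![𝒱, ℋ] := by
  refine LinearIndependent.pair_iff.2 fun s t hst => ?_
  have hst (x : E) : s * 𝒱 x + t * ℋ x = 0 := DFunLike.congr_fun hst x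
  obtain ⟨x, hx, h𝒱x⟩ := h.exists_mem_H_apply_ne_zero 0
  obtain ⟨y, hy, hℋy⟩ := h.swap.exists_mem_H_apply_ne_zero 0
  have hsx := hst x
  have hty := hst y
  rw [h.apply_H 0 x hx, mul_zero, add_zero] at hsx
  rw [h.apply_V 0 y hy, mul_zero, zero_add] at hty
  exact ⟨(mul_eq_zero.1 hsx).resolve_right h𝒱x, (mul_eq_zero.1 hty).resolve_right hℋy⟩

end IsDecomposition

end InscribedNet

section Generators

open Module

theorem finrank_inf_add_finrank_of_isCompl {K E : Type*} [Field K] [AddCommGroup E] [Module K E]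
    [FiniteDimensional K E] {F R W : Submodule K E} (hF : IsCompl F R) (hRW : R ≤ W) :
    finrank K ↥(F ⊓ W) + finrank K R = finrank K W := by
  have hsup : R ⊔ F ⊓ W = W := by
    rw [← sup_inf_assoc_of_le F hRW, hF.symm.sup_eq_top, top_inf_eq]
  have hinf : R ⊓ (F ⊓ W) = ⊥ := by
    rw [← inf_assoc, hF.symm.inf_eq_bot, bot_inf_eq]
  have hdim := Submodule.finrank_sup_add_finrank_inf_eq R (F ⊓ W)
  rw [hsup, hinf, finrank_bot, add_zero] at hdim
  rw [hdim, add_comm]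

theorem projDim_eq_iff {n d : ℕ} {S : Submodule ℝ (HomCoord n)} :
    projDim S = d ↔ finrank ℝ S = d + 1 := by
  rw [projDim]
  omega

theorem finrank_homCoord (n : ℕ) : finrank ℝ (HomCoord n) = n + 1 := by
  rw [finrank_fin_fun]

theorem isPencil_span {n : ℕ} {q₁ q₂ : QuadraticForm ℝ (HomCoord n)}
    (h : LinearIndependent ℝ ![q₁, q₂]) : IsPencil (Submodule.span ℝ {q₁, q₂}) := by
  rw [← Matrix.range_cons_cons_empty, IsPencil, finrank_span_eq_card h, Fintype.card_fin]

/-- The system of generators of the quadric of `q` to which the generator `G` belongs. -/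
def systemOf {m : ℕ} (q : QuadraticForm ℝ (HomCoord (2 * m)))
    (G : Submodule ℝ (HomCoord (2 * m))) : Set (Submodule ℝ (HomCoord (2 * m))) :=
  {G' | IsGenerator q G' ∧ SameSystem q G G'}

/-- The quadric of `q` in `ℝP²ᵐ` is a cone, with a single point as apex, over a quadric that
contains projective subspaces of the largest possible dimension. Such a form has signature
`(m, m, 1)`; isotropic subspaces are used instead of signs since a net provides them directly. -/
structure IsNeutralCone {m : ℕ} (q : QuadraticForm ℝ (HomCoord (2 * m))) : Prop where
  finrank_radical : finrank ℝ (QuadraticMap.radical q) = 1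
  exists_isotropic : ∃ G, IsIsotropic q G ∧ finrank ℝ G = m + 1

namespace IsNeutralCone

variable {m : ℕ} {q : QuadraticForm ℝ (HomCoord (2 * m))} {A B C G : Submodule ℝ (HomCoord (2 * m))}

theorem hasSignature (h : IsNeutralCone q) : HasSignature q m m 1 := by
  obtain ⟨G, hG, hGm⟩ := h.exists_isotropic
  have hpos := QuadraticForm.sigPos_add_finrank_le_of_nonpos (Q := q) (V := G)
    fun x hx => (hG x hx).le
  have hneg := QuadraticForm.sigPos_add_finrank_le_of_nonpos (Q := -q) (V := G)
    fun x hx => (neg_eq_zero.2 (hG x hx)).le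
  have hsum := QuadraticForm.sigPos_add_sigNeg_add_radical (Q := q)
  have hr := h.finrank_radical
  rw [sigPos_neg] at hneg
  rw [finrank_homCoord] at hpos hneg hsum
  exact ⟨by omega, by omega, hr⟩

theorem finrank_ker_polarBilin (h : IsNeutralCone q) :
    finrank ℝ (LinearMap.ker q.polarBilin) = 1 :=
  QuadraticMap.radical_eq_ker_polarBilin (Q := q) ▸ h.finrank_radical

theorem isGenerator_iff (h : IsNeutralCone q) :
    IsGenerator q G ↔ IsIsotropic q G ∧ finrank ℝ G = m + 1 := by
  have hle (G') (hG' : IsIsotropic q G') : finrank ℝ G' ≤ m + 1 := by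
    have hdim := two_mul_finrank_le_of_le_orthogonal (le_orthogonal_polarBilin_of_forall_mem hG')
    rw [finrank_homCoord, h.finrank_ker_polarBilin] at hdim
    omega
  constructor
  · rintro ⟨hG, hmax⟩
    obtain ⟨G₀, hG₀, hG₀m⟩ := h.exists_isotropic
    have hge := hmax G₀ hG₀
    have hGle := hle G hG
    rw [projDim, projDim] at hge
    exact ⟨hG, by omega⟩
  · rintro ⟨hG, hGm⟩
    refine ⟨hG, fun G' hG' => ?_⟩
    have hG'le := hle G' hG'
    rw [projDim, projDim]
    omega

theorem isLagrangian (h : IsNeutralCone q) (hG : IsGenerator q G) :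
    IsLagrangian q.polarBilin G := by
  obtain ⟨hiso, hGm⟩ := h.isGenerator_iff.1 hG
  refine isLagrangian_of_le_two_mul_finrank (le_orthogonal_polarBilin_of_forall_mem hiso) ?_
  have hker := h.finrank_ker_polarBilin
  have hinf := Submodule.finrank_mono
    (inf_le_right : G ⊓ LinearMap.ker q.polarBilin ≤ LinearMap.ker q.polarBilin)
  rw [finrank_homCoord]
  omega

theorem radical_le (h : IsNeutralCone q) (hG : IsGenerator q G) :
    QuadraticMap.radical q ≤ G :=
  QuadraticMap.radical_eq_ker_polarBilin (Q := q) ▸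
    (h.isLagrangian hG).ker_le (isSymm_polarBilin q).isRefl

theorem sameSystem_iff (h : IsNeutralCone q) (hA : IsGenerator q A) (hB : IsGenerator q B) :
    SameSystem q A B ↔ finrank ℝ ↥(A ⊓ B) ≡ m + 1 [MOD 2] := by
  have hF (F) (hF : IsCompl F (QuadraticMap.radical q)) :
      ¬ projDim ((A ⊓ F) ⊓ (B ⊓ F)) ≡ (m : ℤ) [ZMOD 2] ↔
        finrank ℝ ↥(A ⊓ B) ≡ m + 1 [MOD 2] := by
    have hdim := finrank_inf_add_finrank_of_isCompl hF
      (le_inf (h.radical_le hA) (h.radical_le hB))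
    rw [h.finrank_radical] at hdim
    rw [← inf_inf_distrib_right, inf_comm, projDim, ← hdim, Int.ModEq, Nat.ModEq]
    omega
  obtain ⟨F, hcompl⟩ := Submodule.exists_isCompl (QuadraticMap.radical q)
  exact ⟨fun hAB => (hF F hcompl.symm).1 (hAB F hcompl.symm), fun hAB F hcompl =>
    (hF F hcompl).2 hAB⟩

theorem sameSystem_self (h : IsNeutralCone q) (hG : IsGenerator q G) : SameSystem q G G := by
  rw [h.sameSystem_iff hG hG, inf_idem, (h.isGenerator_iff.1 hG).2]

theorem sameSystem_comm (h : IsNeutralCone q) (hA : IsGenerator q A) (hB : IsGenerator q B) :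
    SameSystem q A B ↔ SameSystem q B A := by
  rw [h.sameSystem_iff hA hB, h.sameSystem_iff hB hA, inf_comm]

theorem sameSystem_iff_iff (h : IsNeutralCone q) (hA : IsGenerator q A) (hB : IsGenerator q B)
    (hC : IsGenerator q C) :
    SameSystem q A B ↔ (SameSystem q A C ↔ SameSystem q B C) := by
  have hparity :=
    (h.isLagrangian hA).finrank_inf_add_finrank_inf_add_finrank_inf_modEq (h.isLagrangian hB)
      (h.isLagrangian hC) (isSymm_polarBilin q)
  rw [(h.isGenerator_iff.1 hA).2] at hparity
  rw [h.sameSystem_iff hA hB, h.sameSystem_iff hA hC, h.sameSystem_iff hB hC]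
  simp only [Nat.ModEq] at hparity ⊢
  omega

theorem not_sameSystem_of_finrank_inf (h : IsNeutralCone q) (hA : IsGenerator q A)
    (hB : IsGenerator q B) (hAB : finrank ℝ ↥(A ⊓ B) = m) : ¬ SameSystem q A B := by
  rw [h.sameSystem_iff hA hB, hAB, Nat.ModEq]
  omega

theorem mem_systemOf_self (h : IsNeutralCone q) (hG : IsGenerator q G) : G ∈ systemOf q G :=
  ⟨hG, h.sameSystem_self hG⟩

theorem systemOf_eq_iff (h : IsNeutralCone q) (hA : IsGenerator q A) (hB : IsGenerator q B) :
    systemOf q A = systemOf q B ↔ SameSystem q A B :=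
  ⟨fun hAB => (hAB.ge (h.mem_systemOf_self hB)).2, fun hAB => Set.ext fun _ =>
    and_congr_right fun hC => (h.sameSystem_iff_iff hA hB hC).1 hAB⟩

variable {S : ℤ → Submodule ℝ (HomCoord (2 * m))}

theorem periodic_systemOf (h : IsNeutralCone q) (hS : ∀ i, IsGenerator q (S i))
    (hstep : ∀ i, ¬ SameSystem q (S i) (S (i + 1))) :
    Function.Periodic (fun i => systemOf q (S i)) 2 := fun i => by
  have hstep' := hstep (i + 1)
  rw [add_assoc, h.sameSystem_comm (hS _) (hS _)] at hstep'
  rw [h.systemOf_eq_iff (hS _) (hS _), h.sameSystem_iff_iff (hS _) (hS _) (hS (i + 1))]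
  exact iff_of_false hstep' (hstep i)

theorem alternatesBetweenSystems (h : IsNeutralCone q) (hS : ∀ i, IsGenerator q (S i))
    (hstep : ∀ i, ¬ SameSystem q (S i) (S (i + 1))) : AlternatesBetweenSystems q S := by
  have hper := h.periodic_systemOf hS hstep
  have heven (i : ℤ) : systemOf q (S (2 * i)) = systemOf q (S 0) := by
    rw [mul_comm 2 i]
    exact hper.int_mul_eq i
  have hodd (i : ℤ) : systemOf q (S (2 * i + 1)) = systemOf q (S 1) := by
    rw [mul_comm 2 i, add_comm (i * 2)]
    exact hper.int_mul i 1
  have h01 : ¬ SameSystem q (S 0) (S 1) := hstep 0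
  refine ⟨systemOf q (S 0), systemOf q (S 1), ⟨S 0, hS 0, rfl⟩, ⟨S 1, hS 1, rfl⟩,
    fun heq => h01 ((h.systemOf_eq_iff (hS 0) (hS 1)).1 heq), ?_,
    fun i => (heven i).subset (h.mem_systemOf_self (hS _)),
    fun i => (hodd i).subset (h.mem_systemOf_self (hS _))⟩
  rintro _ ⟨A, hA, rfl⟩
  change systemOf q A = _ ∨ systemOf q A = _
  rw [h.systemOf_eq_iff hA (hS 0), h.systemOf_eq_iff hA (hS 1),
    h.sameSystem_iff_iff hA (hS 0) (hS 1), iff_false_right h01]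
  exact (em _).symm

end IsNeutralCone

end Generators

section Dependencies

open Module

variable {K E : Type*} [Field K] [AddCommGroup E] [Module K E] {x y z w : E}

theorem exists_sum_smul_eq_zero_forall_ne_zero {n : ℕ} {v : Fin (n + 1) → E}
    (hv : ¬ LinearIndependent K v)
    (hli : ∀ k : Fin (n + 1), LinearIndependent K fun i => v (k.succAbove i)) :
    ∃ g : Fin (n + 1) → K, ∑ i, g i • v i = 0 ∧ ∀ i, g i ≠ 0 := by
  obtain ⟨g, hsum, k, hk⟩ := Fintype.not_linearIndependent_iff.1 hv
  refine ⟨g, hsum, fun i hi => ?_⟩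
  rw [Fin.sum_univ_succAbove _ i, hi, zero_smul, zero_add] at hsum
  have hzero := Fintype.linearIndependent_iff.1 (hli i) _ hsum
  obtain rfl | ⟨j, rfl⟩ := Fin.eq_self_or_eq_succAbove i k
  · exact hk hi
  · exact hk (hzero j)

theorem linearIndependent_triple_of_finrank_eq_three
    (h : finrank K ↥(Submodule.span K {x} ⊔ Submodule.span K {y} ⊔ Submodule.span K {z}) = 3) :
    LinearIndependent K ![x, y, z] := by
  rw [linearIndependent_iff_card_eq_finrank_span, Set.finrank, Fintype.card_fin,
    Matrix.range_cons, Matrix.range_cons_cons_empty, Submodule.span_union, Submodule.span_insert,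
    ← sup_assoc, h]

theorem not_linearIndependent_of_finrank_le_three
    (h : finrank K ↥(Submodule.span K {x} ⊔ Submodule.span K {y} ⊔ Submodule.span K {z} ⊔
      Submodule.span K {w}) ≤ 3) : ¬ LinearIndependent K ![x, y, z, w] := by
  intro hli
  have hcard := finrank_span_eq_card hli
  rw [Matrix.range_cons, Matrix.range_cons, Matrix.range_cons_cons_empty, Submodule.span_union,
    Submodule.span_union, Submodule.span_insert, ← sup_assoc, ← sup_assoc,
    Fintype.card_fin] at hcard
  omega

theorem exists_smul_add_eq_zero_forall_ne_zero (hxyzw : ¬ LinearIndependent K ![x, y, z, w])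
    (hxyz : LinearIndependent K ![x, y, z]) (hxyw : LinearIndependent K ![x, y, w])
    (hxzw : LinearIndependent K ![x, z, w]) (hyzw : LinearIndependent K ![y, z, w]) :
    ∃ a b c d : K, a • x + b • y + c • z + d • w = 0 ∧ a ≠ 0 ∧ b ≠ 0 ∧ c ≠ 0 ∧ d ≠ 0 := by
  obtain ⟨g, hsum, hg⟩ := exists_sum_smul_eq_zero_forall_ne_zero hxyzw fun k => by
    fin_cases k
    · convert hyzw using 1; ext i; fin_cases i <;> rfl
    · convert hxzw using 1; ext i; fin_cases i <;> rfl
    · convert hxyw using 1; ext i; fin_cases i <;> rfl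
    · convert hxyz using 1; ext i; fin_cases i <;> rfl
  rw [Fin.sum_univ_four] at hsum
  exact ⟨g 0, g 1, g 2, g 3, hsum, hg 0, hg 1, hg 2, hg 3⟩

theorem polarBilin_ne_zero_of_not_forall_mem {Q : QuadraticForm K E} (hx : Q x = 0)
    (hy : Q y = 0) (h : ¬ ∀ z ∈ Submodule.span K {x} ⊔ Submodule.span K {y}, Q z = 0) :
    Q.polarBilin x y ≠ 0 := by
  contrapose! h
  intro z hz
  rw [← Submodule.span_insert, Submodule.mem_span_pair] at hz
  obtain ⟨s, t, rfl⟩ := hz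
  rw [map_smul_add_smul_of_map_eq_zero Q hx hy, h, mul_zero]

end Dependencies

section GenericNets

open Module

variable {m : ℕ} {Q : QuadraticForm ℝ (HomCoord (2 * m))} {P : ℤ → ℤ → RP (2 * m)}
  {V H : ℤ → Submodule ℝ (HomCoord (2 * m))}

theorem rowSpan_rep {n : ℕ} (P : ℤ → ℤ → RP n) (i : ℤ) :
    rowSpan ℝ (fun i j => (P i j).rep) i = ⨆ j, (P i j).submodule := by
  simp only [rowSpan, Submodule.span_range_eq_iSup, Projectivization.submodule_eq]

theorem rowSpan_rep_eq {n d : ℕ} {P : ℤ → ℤ → RP n} {i : ℤ} {W : Submodule ℝ (HomCoord n)}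
    (hW : projDim W = d) (hPW : ∀ j, (P i j).submodule ≤ W)
    (hjoin : projDim (⨆ k : Fin (d + 1), (P i (0 + (k : ℕ))).submodule) = d) :
    rowSpan ℝ (fun i j => (P i j).rep) i = W := by
  rw [rowSpan_rep]
  refine Submodule.eq_of_le_of_finrank_le (iSup_le hPW) ?_
  rw [projDim_eq_iff.1 hW, ← projDim_eq_iff.1 hjoin]
  exact Submodule.finrank_mono (iSup_le fun k => le_iSup (fun j => (P i j).submodule) _)

theorem exists_quadCoeffs_isNet (hP : IsQNet P) (hgen : IsGenericNet Q P V H) :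
    ∃ g : QuadCoeffs ℝ, g.IsNet fun i j => (P i j).rep := by
  have hrel (i j) : ∃ a b c d : ℝ, a • (P i j).rep + b • (P (i + 1) j).rep +
      c • (P i (j + 1)).rep + d • (P (i + 1) (j + 1)).rep = 0 ∧
      a ≠ 0 ∧ b ≠ 0 ∧ c ≠ 0 ∧ d ≠ 0 := by
    have hplane := hP i j
    have hquad₁ := hgen.quad₁ i j
    have hquad₂ := hgen.quad₂ i j
    have hquad₃ := hgen.quad₃ i j
    have hquad₄ := hgen.quad₄ i j
    rw [sup_right_comm] at hplane
    simp only [Projectivization.submodule_eq] at hplane hquad₁ hquad₂ hquad₃ hquad₄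
    simp only [projDim] at hplane hquad₁ hquad₂ hquad₃ hquad₄
    exact exists_smul_add_eq_zero_forall_ne_zero
      (not_linearIndependent_of_finrank_le_three (by omega))
      (linearIndependent_triple_of_finrank_eq_three (by omega))
      (linearIndependent_triple_of_finrank_eq_three (by omega))
      (linearIndependent_triple_of_finrank_eq_three (by omega))
      (linearIndependent_triple_of_finrank_eq_three (by omega))
  choose a b c d hnet ha hb hc hd using hrel
  exact ⟨⟨a, b, c, d, ha, hb, hc, hd⟩, hnet⟩

theorem exists_inscribedNet (hP : IsQNet P) (hPQ : ∀ i j, IsIsotropic Q (P i j).submodule)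
    (hVdim : ∀ i, projDim (V i) = m) (hHdim : ∀ j, projDim (H j) = m)
    (hPV : ∀ i j, (P i j).submodule ≤ V i) (hPH : ∀ i j, (P i j).submodule ≤ H j)
    (hgen : IsGenericNet Q P V H) :
    ∃ N : InscribedNet ℝ (HomCoord (2 * m)), N.Q = Q ∧ N.V = V ∧ N.H = H := by
  let p : ℤ → ℤ → HomCoord (2 * m) := fun i j => (P i j).rep
  obtain ⟨g, hg⟩ : ∃ g : QuadCoeffs ℝ, g.IsNet p := exists_quadCoeffs_isNet hP hgen
  have hV (i) : rowSpan ℝ p i = V i := rowSpan_rep_eq (hVdim i) (hPV i) (hgen.join_V i 0)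
  have hH (j) : rowSpan ℝ (flip p) j = H j :=
    rowSpan_rep_eq (P := flip P) (hHdim j) (fun i => hPH i j) (hgen.join_H 0 j)
  have htop : ⨆ i, rowSpan ℝ p i = ⊤ := by
    simp only [p, rowSpan_rep, hgen.span_eq_top]
  have hiso (i j) : Q (p i j) = 0 :=
    hPQ i j _ ((P i j).submodule_eq ▸ Submodule.mem_span_singleton_self _)
  have hdim (i j) : finrank ℝ (rowSpan ℝ p i) + finrank ℝ (rowSpan ℝ (flip p) j) =
      finrank ℝ (HomCoord (2 * m)) + 1 := by
    rw [hV, hH, projDim_eq_iff.1 (hVdim i), projDim_eq_iff.1 (hHdim j), finrank_homCoord]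
    ring
  have hrow := hgen.edge_V
  have hcol := hgen.edge_H
  simp only [Projectivization.submodule_eq] at hrow hcol
  let N : InscribedNet ℝ (HomCoord (2 * m)) :=
    { coeffs := g
      Q := Q
      p := p
      isNet := hg
      isotropic := hiso
      polar_row := fun i j =>
        polarBilin_ne_zero_of_not_forall_mem (hiso _ _) (hiso _ _) (hrow i j)
      polar_col := fun i j =>
        polarBilin_ne_zero_of_not_forall_mem (hiso _ _) (hiso _ _) (hcol i j)
      rowSpan_inf_le := fun i j =>
        hg.rowSpan_inf_rowSpan_flip_le htop (P i j).rep_nonzero (hdim i j)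
      iSup_rowSpan := htop }
  exact ⟨N, rfl, funext hV, funext hH⟩

end GenericNets

namespace InscribedNet

variable {m : ℕ} {N : InscribedNet ℝ (HomCoord (2 * m))}
  {𝒱 ℋ : QuadraticForm ℝ (HomCoord (2 * m))}

namespace IsDecomposition

theorem isNeutralCone (h : N.IsDecomposition 𝒱 ℋ) (hV : ∀ i, projDim (N.V i) = m) {i : ℤ}
    (hinter : projDim (⨅ k : Fin (m + 1), N.V (i + (k : ℕ))) = 0) : IsNeutralCone 𝒱 where
  finrank_radical := by
    rw [QuadraticMap.radical_eq_ker_polarBilin]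
    exact h.finrank_ker_polarBilin (finrank_homCoord _) (projDim_eq_iff.1 (hV i))
      (projDim_eq_iff.1 (hinter.trans Nat.cast_zero.symm))
  exists_isotropic := ⟨N.V i, h.apply_V i, projDim_eq_iff.1 (hV i)⟩

theorem alternatesBetweenSystems (h : N.IsDecomposition 𝒱 ℋ) (hcone : IsNeutralCone 𝒱)
    (hV : ∀ i, projDim (N.V i) = m) : AlternatesBetweenSystems 𝒱 N.V := by
  have hgen (i) : IsGenerator 𝒱 (N.V i) :=
    hcone.isGenerator_iff.2 ⟨h.apply_V i, projDim_eq_iff.1 (hV i)⟩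
  refine hcone.alternatesBetweenSystems hgen fun i =>
    hcone.not_sameSystem_of_finrank_inf (hgen i) (hgen (i + 1)) ?_
  have hdim := N.finrank_V_eq_finrank_inf_succ_add_one i
  rw [projDim_eq_iff.1 (hV i)] at hdim
  omega

end IsDecomposition

end InscribedNet

theorem mainTheorem6_general (m : ℕ) (Q : QuadraticForm ℝ (HomCoord (2 * m)))
    (P : ℤ → ℤ → RP (2 * m)) (hP : IsQNet P)
    (hPQ : ∀ i j : ℤ, IsIsotropic Q (P i j).submodule)
    (V H : ℤ → Submodule ℝ (HomCoord (2 * m)))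
    (hVdim : ∀ i : ℤ, projDim (V i) = m) (hHdim : ∀ j : ℤ, projDim (H j) = m)
    (hPV : ∀ i j : ℤ, (P i j).submodule ≤ V i) (hPH : ∀ i j : ℤ, (P i j).submodule ≤ H j)
    (hgen : IsGenericNet Q P V H) :
    ∃ 𝒱 ℋ : QuadraticForm ℝ (HomCoord (2 * m)),
      (HasSignature 𝒱 m m 1 ∧ ∀ i : ℤ, IsIsotropic 𝒱 (V i)) ∧
      (HasSignature ℋ m m 1 ∧ ∀ j : ℤ, IsIsotropic ℋ (H j)) ∧
      AlternatesBetweenSystems 𝒱 V ∧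
      AlternatesBetweenSystems ℋ H ∧
      ∃ L : Submodule ℝ (QuadraticForm ℝ (HomCoord (2 * m))),
        IsPencil L ∧ Q ∈ L ∧ 𝒱 ∈ L ∧ ℋ ∈ L := by
  obtain ⟨N, rfl, rfl, rfl⟩ := exists_inscribedNet hP hPQ hVdim hHdim hPV hPH hgen
  obtain ⟨𝒱, ℋ, h⟩ := N.exists_isDecomposition
  have hcone𝒱 : IsNeutralCone 𝒱 := h.isNeutralCone hVdim (hgen.inter_V 0)
  have hconeℋ : IsNeutralCone ℋ := h.swap.isNeutralCone hHdim (hgen.inter_H 0)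
  have h𝒱 : 𝒱 ∈ Submodule.span ℝ {𝒱, ℋ} := Submodule.mem_span_of_mem (Set.mem_insert _ _)
  have hℋ : ℋ ∈ Submodule.span ℝ {𝒱, ℋ} := Submodule.mem_span_of_mem (Set.mem_insert_of_mem _ rfl)
  exact ⟨𝒱, ℋ, ⟨hcone𝒱.hasSignature, h.apply_V⟩, ⟨hconeℋ.hasSignature, h.apply_H⟩,
    h.alternatesBetweenSystems hcone𝒱 hVdim, h.swap.alternatesBetweenSystems hconeℋ hHdim,
    Submodule.span ℝ {𝒱, ℋ}, isPencil_span h.linearIndependent, h.add_eq ▸ add_mem h𝒱 hℋ, h𝒱, hℋ⟩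

theorem mainTheorem6 (m : ℕ) (hm : 2 ≤ m)
    (Q : QuadraticForm ℝ (HomCoord (2 * m))) (hQ : (QuadraticMap.polarBilin Q).Nondegenerate)
    (P : ℤ → ℤ → RP (2 * m)) (hP : IsQNet P)
    (hPQ : ∀ i j : ℤ, IsIsotropic Q (P i j).submodule)
    (V H : ℤ → Submodule ℝ (HomCoord (2 * m)))
    (hVdim : ∀ i : ℤ, projDim (V i) = m) (hHdim : ∀ j : ℤ, projDim (H j) = m)
    (hPV : ∀ i j : ℤ, (P i j).submodule ≤ V i) (hPH : ∀ i j : ℤ, (P i j).submodule ≤ H j)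
    (hgen : IsGenericNet Q P V H) :
    ∃ 𝒱 ℋ : QuadraticForm ℝ (HomCoord (2 * m)),
      (HasSignature 𝒱 m m 1 ∧ ∀ i : ℤ, IsIsotropic 𝒱 (V i)) ∧
      (HasSignature ℋ m m 1 ∧ ∀ j : ℤ, IsIsotropic ℋ (H j)) ∧
      AlternatesBetweenSystems 𝒱 V ∧
      AlternatesBetweenSystems ℋ H ∧
      ∃ L : Submodule ℝ (QuadraticForm ℝ (HomCoord (2 * m))),
        IsPencil L ∧ Q ∈ L ∧ 𝒱 ∈ L ∧ ℋ ∈ L := by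
  exact mainTheorem6_general m Q P hP hPQ V H hVdim hHdim hPV hPH hgen
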